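/- For an integer $m\ge 0$ let $\gamma_m(\zeta)=(\pi\, m!)^{-1/2}\,\bar\zeta^{\,m}e^{-|\zeta|^2/2}$ $(\zeta\in\mathbb C)$ be the Landau state of angular momentum $-m$ at unit field strength, and put $$V_m(x)=\int_{\mathbb C}\frac{|\gamma_m(\zeta)|^2}{\sqrt{x^2+|\zeta|^2}}\,d^2\zeta,\qquad W_{m,m}(u)=\int_{\mathbb C}\int_{\mathbb C}\frac{|\gamma_m(\zeta)|^2|\gamma_m(\zeta')|^2}{\sqrt{u^2+|\zeta-\zeta'|^2}}\,d^2\zeta\,d^2\zeta' .$$ For real $Z>0$, $M>0$ and integers $N\ge 0$ the $m$-momentum Landau model is the Hamiltonian on $L^2(\mathbb R^N)$ $$h^m(N,Z,M)=\sum_{j=1}^N\Big[-\frac1M\frac{d^2}{dx_j^2}-Z\,V_m(x_j)\Big]+\sum_{1\le j<k\le N}W(|x_j-x_k|),\qquad W=W_{m,m}.$$ For $B>0$ let $E_0(N,Z,B)=\inf\langle\Phi,h^m(N,Z,B^{-1/2})\Phi\rangle$, the infimum being over $\Phi\in C_c^\infty(\mathbb R^N;\mathbb C)$ with $\|\Phi\|_{L^2}=1$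 (so $E_0(0,Z,B)=0$), and let $N_{\max}(Z,B)$ be the supremum (in $[-\infty,\infty]$) of the integers $N\ge1$ with $E_0(N,Z,B)<E_0(N-1,Z,B)$. Fix $m$. All constants below may depend on $m$. (i) There are constants $a_1,a_2>0$ such that for every $\alpha>0$ there is a constant $A_\alpha>0$ with the following property: for all $\varepsilon>0$, all real $Z\ge1$ and all $B$ with $a_1e^{Z^{\alpha/4}}>B\ge a_2Z^{2+\varepsilon}$, $$N_{\max}(Z,B)\le 2Z+A_\alpha Z^{1+\alpha}.$$ (ii) For every $a>0$ and $p>3$ there is a constant $A>0$ (depending on $a$ and $p$) such that for all real $Z\ge2$, with $B=aZ^p$, $$N_{\max}(Z,B)\le 3Z+A\,Z(\log Z)^2 .$$ Both statements also hold, with possibly different constants, for the model in which $W$ is instead $W(u)=\frac1{\sqrt2}V_{2m}\big(\frac{u}{\sqrt2}\big)$. -/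

import Mathlib

open MeasureTheory Filter Topology
open scoped ContDiff ComplexConjugate

noncomputable section

namespace LandauModel

/-- The lowest-band Landau state of angular momentum `-m` at field strength one, in the complex
coordinate `ζ` of the plane orthogonal to the field:
`γ_m(ζ) = (π m!)^{-1/2} (conj ζ)^m exp(-|ζ|²/2)`. -/
def landauState (m : ℕ) (ζ : ℂ) : ℂ :=
  (((Real.sqrt (Real.pi * (m.factorial : ℝ)))⁻¹ : ℝ) : ℂ) * (conj ζ) ^ m
    * ((Real.exp (-‖ζ‖ ^ 2 / 2) : ℝ) : ℂ)

/-- The regularized Coulomb potential `V_m(x) = ⟨γ_m, |r|⁻¹ γ_m⟩`, where `r = (x, ζ)`. -/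
def V (m : ℕ) (x : ℝ) : ℝ :=
  ∫ ζ : ℂ, ‖landauState m ζ‖ ^ 2 / Real.sqrt (x ^ 2 + ‖ζ‖ ^ 2)

/-- The effective interaction
`W_{m,m'}(x - x') = ⟨γ_m ⊗ γ_{m'}, |r - r'|⁻¹ γ_m ⊗ γ_{m'}⟩` as a function of `u = x - x'`. -/
def W (m m' : ℕ) (u : ℝ) : ℝ :=
  ∫ p : ℂ × ℂ, ‖landauState m p.1‖ ^ 2 * ‖landauState m' p.2‖ ^ 2
    / Real.sqrt (u ^ 2 + ‖p.1 - p.2‖ ^ 2)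

/-- The interaction `u ↦ 2^{-1/2} V_{2m}(u / √2)`, a pointwise lower bound of `W m m`. -/
def WLower (m : ℕ) (u : ℝ) : ℝ :=
  (Real.sqrt 2)⁻¹ * V (2 * m) (u / Real.sqrt 2)

/-- The second partial derivative `∂²Φ/∂x_j²`. -/
def secondPartial {N : ℕ} (j : Fin N) (Φ : (Fin N → ℝ) → ℂ) (x : Fin N → ℝ) : ℂ :=
  iteratedDeriv 2 (fun t : ℝ => Φ (Function.update x j t)) (x j)

/-- The `N`-electron Hamiltonian
`h = ∑_j [-(1/M) d²/dx_j² - Z v(x_j)] + ∑_{j<k} w(|x_j - x_k|)`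
with one-body potential `v`, interaction `w`, nuclear charge `Z` and mass `M`. -/
def hamiltonian (v w : ℝ → ℝ) (N : ℕ) (Z M : ℝ) (Φ : (Fin N → ℝ) → ℂ) (x : Fin N → ℝ) : ℂ :=
  (∑ j : Fin N, (-((1 / M : ℝ) : ℂ) * secondPartial j Φ x - ((Z * v (x j) : ℝ) : ℂ) * Φ x))
    + ∑ j : Fin N, ∑ k ∈ Finset.Ioi j, ((w |x j - x k| : ℝ) : ℂ) * Φ x

/-- Normalized wave functions in `C_c^∞(ℝ^N)`. For bounded potentials this space is a core of the
self-adjoint realization of the Hamiltonian, so the infimum below is the bottom of the spectrum. -/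
structure IsTrial {N : ℕ} (Φ : (Fin N → ℝ) → ℂ) : Prop where
  smooth : ContDiff ℝ ∞ Φ
  compactSupport : HasCompactSupport Φ
  normalized : ∫ x, ‖Φ x‖ ^ 2 = 1

/-- The ground-state energy `inf_{‖Φ‖ = 1} ⟨Φ, h(N, Z, M) Φ⟩`. -/
def groundEnergy (v w : ℝ → ℝ) (N : ℕ) (Z M : ℝ) : EReal :=
  ⨅ (Φ : (Fin N → ℝ) → ℂ) (_ : IsTrial Φ),
    (((∫ x, conj (Φ x) * hamiltonian v w N Z M Φ x).re : ℝ) : EReal)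

/-- `h(N, Z, B^{-1/2})` has a bound state, in the sense `E₀(N, Z, B) < E₀(N - 1, Z, B)`. -/
def HasBoundState (v w : ℝ → ℝ) (N : ℕ) (Z B : ℝ) : Prop :=
  1 ≤ N ∧ groundEnergy v w N Z (B ^ (-(1 / 2) : ℝ)) < groundEnergy v w (N - 1) Z (B ^ (-(1 / 2) : ℝ))

/-- The maximal number of electrons that can be bound, `N_max(Z, B)`; it is `⊤` if there is no
maximum. -/
def Nmax (v w : ℝ → ℝ) (Z B : ℝ) : EReal :=
  ⨆ (N : ℕ) (_ : HasBoundState v w N Z B), ((N : ℝ) : EReal)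

end LandauModel

end

/-!
Let `e < E₀(n)` and let `Φ` be a state of `n + 1` electrons. Put `L = √B / Z`, `R = 1 + L`, and
write `Φ = √G • ψ` with `G(x) = ∑ k, √(R² + x_k²)`. Up to a nonnegative term, the energy of `Φ`
relative to `e` is the sum over `k` of three contributions:

* the energy relative to `e` of the electrons other than the `k`-th one, weighted with
  `√(R² + x_k²)`, which is nonnegative because `e < E₀(n)`;
* the repulsion between the `k`-th electron and the others, with the same weight; after
  symmetrization each pair contributes at least a constant, since
  `√(R² + x²) + √(R² + y²) ≥ (1 + |x - y|) / 2`, so that the total is at least of order `n²`;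
* a one-body term, in which the weighted attraction is of order `Z R (1 + x²)^{-1/2}`. Up to `O(Z)`
  this is `Z R` times the derivative of `arsinh x - arsinh (x / R)`, a function bounded by `log R`.
  After an integration by parts the kinetic energy therefore absorbs it at the cost of
  `O(Z (1 + log² R))`.

Hence `E₀(n) ≤ E₀(n + 1)` as soon as `n` exceeds a multiple of `Z (1 + log² R)`. In the two regimes
`log R` is `O(Z^{α/2})` and `O(log Z)` respectively.
-/

noncomputable section

namespace LandauModel

section CoulombPotential

variable {Ω : Type*} [MeasurableSpace Ω] {μ : Measure Ω} {ρ r : Ω → ℝ}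

/-- The Coulomb potential, at height `u` on an axis, of a charge spread over the space `Ω` with
density `ρ`, the charge at `y` having distance `r y` from the axis. The potentials `V m`, `W m m'`
and `WLower m` are all of this form. -/
def coulombPotential (μ : Measure Ω) (ρ r : Ω → ℝ) (u : ℝ) : ℝ :=
  ∫ y, ρ y / √(u ^ 2 + r y ^ 2) ∂μ

/-- A nonnegative charge density `ρ` for which the Coulomb potential, with `r` the distance from
the axis, is finite on the axis. -/
structure IsChargeDensity (μ : Measure Ω) (ρ r : Ω → ℝ) : Prop where
  measurable : Measurable ρ
  measurable_dist : Measurable r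
  nonneg : ∀ y, 0 ≤ ρ y
  ae_dist_pos : ∀ᵐ y ∂μ, 0 < r y
  integrable : Integrable ρ μ
  integrable_div_dist : Integrable (fun y => ρ y / r y) μ

/-- A bounded measurable function. The potentials of the model are of this kind, so that all the
energies below are finite. -/
structure IsBoundedMeasurable {X : Type*} [MeasurableSpace X] (f : X → ℝ) : Prop where
  measurable : Measurable f
  exists_abs_le : ∃ D, ∀ x, |f x| ≤ D

/-- A one-body potential `v` whose negative attracts electrons at most like a Coulomb potential of
charge `C` smeared out over unit length. -/
structure IsAttraction (v : ℝ → ℝ) (C : ℝ) : Prop where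
  measurable : Measurable v
  nonneg : ∀ x, 0 ≤ v x
  le : ∀ x, v x ≤ C / √(1 + x ^ 2)

/-- A bounded pair interaction `w` that dominates a Coulomb repulsion of strength `c` smeared out
over unit length. -/
structure IsRepulsion (w : ℝ → ℝ) (c : ℝ) : Prop where
  measurable : Measurable w
  bddAbove : BddAbove (Set.range w)
  pos : 0 < c
  ge : ∀ u, c / (1 + |u|) ≤ w u

lemma IsAttraction.abs_le {v : ℝ → ℝ} {C : ℝ} (hv : IsAttraction v C) (x : ℝ) : |v x| ≤ C := by
  have hs : 1 ≤ √(1 + x ^ 2) := Real.one_le_sqrt.2 (by nlinarith [sq_nonneg x])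
  have hC : 0 ≤ C := by
    by_contra! hC
    exact ((hv.nonneg x).trans (hv.le x)).not_gt (div_neg_of_neg_of_pos hC (by positivity))
  rw [abs_of_nonneg (hv.nonneg x)]
  exact (hv.le x).trans (div_le_self hC hs)

lemma IsAttraction.const_nonneg {v : ℝ → ℝ} {C : ℝ} (hv : IsAttraction v C) : 0 ≤ C :=
  (abs_nonneg (v 0)).trans (hv.abs_le 0)

lemma IsAttraction.isBoundedMeasurable {v : ℝ → ℝ} {C : ℝ} (hv : IsAttraction v C) :
    IsBoundedMeasurable v :=
  ⟨hv.measurable, C, hv.abs_le⟩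

lemma IsRepulsion.isBoundedMeasurable {w : ℝ → ℝ} {c : ℝ} (hw : IsRepulsion w c) :
    IsBoundedMeasurable w := by
  obtain ⟨D, hD⟩ := hw.bddAbove
  refine ⟨hw.measurable, D, fun u => ?_⟩
  have hc := hw.pos
  rw [abs_of_nonneg (le_trans (by positivity) (hw.ge u))]
  exact hD ⟨u, rfl⟩

lemma inv_sqrt_sq_add_sq_le (a : ℝ) {b : ℝ} (hb : 0 < b) : (√(a ^ 2 + b ^ 2))⁻¹ ≤ b⁻¹ :=
  inv_anti₀ hb (Real.le_sqrt_of_sq_le (by nlinarith [sq_nonneg a]))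

lemma inv_sqrt_sq_add_sq_le_div (a : ℝ) {b : ℝ} (hb : 0 < b) :
    (√(a ^ 2 + b ^ 2))⁻¹ ≤ (1 + b⁻¹) / √(1 + a ^ 2) := by
  have hsq : 1 + a ^ 2 ≤ (1 + b⁻¹) ^ 2 * (a ^ 2 + b ^ 2) := by
    have hexpand : (1 + b⁻¹) ^ 2 * (a ^ 2 + b ^ 2)
        = 1 + a ^ 2 + (a ^ 2 * (2 * b⁻¹ + b⁻¹ ^ 2) + 2 * b + b ^ 2) := by
      field_simp
      ring
    have hrest : 0 ≤ a ^ 2 * (2 * b⁻¹ + b⁻¹ ^ 2) + 2 * b + b ^ 2 := by positivity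
    linarith
  rw [inv_eq_one_div, div_le_div_iff₀ (by positivity) (by positivity), one_mul,
    Real.sqrt_le_left (by positivity), mul_pow, Real.sq_sqrt (by positivity)]
  exact hsq

lemma one_div_le_inv_sqrt_sq_add_sq (a : ℝ) {b : ℝ} (hb : 0 < b) :
    1 / ((1 + |a|) * (1 + b)) ≤ (√(a ^ 2 + b ^ 2))⁻¹ := by
  rw [← one_div]
  refine one_div_le_one_div_of_le (by positivity) ?_
  rw [Real.sqrt_le_left (by positivity), ← sq_abs a]
  calc |a| ^ 2 + b ^ 2 ≤ (|a| + b) ^ 2 := by nlinarith [abs_nonneg a]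
    _ ≤ ((1 + |a|) * (1 + b)) ^ 2 := by
      gcongr
      nlinarith [abs_nonneg a]

namespace IsChargeDensity

lemma integrable_div_sqrt (h : IsChargeDensity μ ρ r) (u : ℝ) :
    Integrable (fun y => ρ y / √(u ^ 2 + r y ^ 2)) μ := by
  have := h.measurable
  have := h.measurable_dist
  refine h.integrable_div_dist.mono' (Measurable.aestronglyMeasurable (by fun_prop)) ?_
  filter_upwards [h.ae_dist_pos] with y hy
  rw [Real.norm_of_nonneg (div_nonneg (h.nonneg y) (Real.sqrt_nonneg _)), div_eq_mul_inv,
    div_eq_mul_inv]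
  exact mul_le_mul_of_nonneg_left (inv_sqrt_sq_add_sq_le u hy) (h.nonneg y)

lemma integrable_div_one_add_dist (h : IsChargeDensity μ ρ r) :
    Integrable (fun y => ρ y / (1 + r y)) μ := by
  have := h.measurable
  have := h.measurable_dist
  refine h.integrable.mono' (Measurable.aestronglyMeasurable (by fun_prop)) ?_
  filter_upwards [h.ae_dist_pos] with y hy
  have := h.nonneg y
  rw [Real.norm_of_nonneg (by positivity)]
  exact div_le_self this (by linarith)

lemma integral_div_one_add_dist_pos (h : IsChargeDensity μ ρ r) (hρ : 0 < ∫ y, ρ y ∂μ) :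
    0 < ∫ y, ρ y / (1 + r y) ∂μ := by
  have hnonneg : 0 ≤ᵐ[μ] fun y => ρ y / (1 + r y) := by
    filter_upwards [h.ae_dist_pos] with y hy
    exact div_nonneg (h.nonneg y) (by linarith)
  have hsupport : Function.support (fun y => ρ y / (1 + r y)) =ᵐ[μ] Function.support ρ := by
    filter_upwards [h.ae_dist_pos] with y hy
    have hy' : 1 + r y ≠ 0 := by positivity
    change (ρ y / (1 + r y) ≠ 0) = (ρ y ≠ 0)
    simp only [ne_eq, div_eq_zero_iff, hy', or_false]
  rw [integral_pos_iff_support_of_nonneg_ae hnonneg h.integrable_div_one_add_dist,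
    measure_congr hsupport]
  exact (integral_pos_iff_support_of_nonneg h.nonneg h.integrable).1 hρ

lemma measurable_coulombPotential [SFinite μ] (h : IsChargeDensity μ ρ r) :
    Measurable (coulombPotential μ ρ r) := by
  have := h.measurable
  have := h.measurable_dist
  have hm : StronglyMeasurable fun p : ℝ × Ω => ρ p.2 / √(p.1 ^ 2 + r p.2 ^ 2) :=
    Measurable.stronglyMeasurable (by fun_prop)
  exact (hm.integral_prod_right (ν := μ)).measurable

lemma isAttraction [SFinite μ] (h : IsChargeDensity μ ρ r) :
    IsAttraction (coulombPotential μ ρ r) (∫ y, (ρ y + ρ y / r y) ∂μ) where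
  measurable := h.measurable_coulombPotential
  nonneg u := integral_nonneg fun y => div_nonneg (h.nonneg y) (Real.sqrt_nonneg _)
  le u := by
    rw [← integral_div]
    refine integral_mono_ae (h.integrable_div_sqrt u)
      ((h.integrable.add h.integrable_div_dist).div_const _) ?_
    filter_upwards [h.ae_dist_pos] with y hy
    calc ρ y / √(u ^ 2 + r y ^ 2) = ρ y * (√(u ^ 2 + r y ^ 2))⁻¹ := div_eq_mul_inv _ _
      _ ≤ ρ y * ((1 + (r y)⁻¹) / √(1 + u ^ 2)) :=
        mul_le_mul_of_nonneg_left (inv_sqrt_sq_add_sq_le_div u hy) (h.nonneg y)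
      _ = (ρ y + ρ y / r y) / √(1 + u ^ 2) := by ring

lemma isRepulsion [SFinite μ] (h : IsChargeDensity μ ρ r) (hρ : 0 < ∫ y, ρ y ∂μ) :
    IsRepulsion (coulombPotential μ ρ r) (∫ y, ρ y / (1 + r y) ∂μ) where
  measurable := h.measurable_coulombPotential
  bddAbove := ⟨_, Set.forall_mem_range.2 fun u => (le_abs_self _).trans (h.isAttraction.abs_le u)⟩
  pos := h.integral_div_one_add_dist_pos hρ
  ge u := by
    rw [← integral_div]
    refine integral_mono_ae (h.integrable_div_one_add_dist.div_const _)
      (h.integrable_div_sqrt u) ?_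
    filter_upwards [h.ae_dist_pos] with y hy
    calc ρ y / (1 + r y) / (1 + |u|) = ρ y * (1 / ((1 + |u|) * (1 + r y))) := by
          rw [div_div, mul_comm (1 + r y), mul_one_div]
      _ ≤ ρ y * (√(u ^ 2 + r y ^ 2))⁻¹ :=
        mul_le_mul_of_nonneg_left (one_div_le_inv_sqrt_sq_add_sq u hy) (h.nonneg y)
      _ = ρ y / √(u ^ 2 + r y ^ 2) := (div_eq_mul_inv _ _).symm

lemma const_mul_dist (h : IsChargeDensity μ ρ r) {a : ℝ} (ha : 0 < a) :
    IsChargeDensity μ ρ (fun y => a * r y) where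
  measurable := h.measurable
  measurable_dist := h.measurable_dist.const_mul a
  nonneg := h.nonneg
  ae_dist_pos := h.ae_dist_pos.mono fun _ hy => mul_pos ha hy
  integrable := h.integrable
  integrable_div_dist := by
    simpa only [div_mul_eq_div_div_swap] using h.integrable_div_dist.div_const a

end IsChargeDensity

end CoulombPotential

section LandauDensity

variable (m m' : ℕ)

/-- The probability density `|γ_m|²` of the Landau state in the transversal plane. -/
def landauDensity (ζ : ℂ) : ℝ := ‖landauState m ζ‖ ^ 2

lemma landauDensity_eq (ζ : ℂ) :
    landauDensity m ζ = (Real.pi * m.factorial)⁻¹ * (‖ζ‖ ^ (2 * m) * Real.exp (-‖ζ‖ ^ 2)) := by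
  have hexp : Real.exp (-‖ζ‖ ^ 2 / 2) ^ 2 = Real.exp (-‖ζ‖ ^ 2) := by
    rw [← Real.exp_nat_mul]
    push_cast
    ring_nf
  simp only [landauDensity, landauState, norm_mul, norm_pow, Complex.norm_real, RCLike.norm_conj,
    Real.norm_eq_abs, mul_pow, sq_abs]
  rw [inv_pow, Real.sq_sqrt (by positivity), hexp, ← pow_mul, mul_comm m 2, mul_assoc]

lemma landauDensity_nonneg (ζ : ℂ) : 0 ≤ landauDensity m ζ := sq_nonneg _

@[fun_prop]
lemma continuous_landauDensity : Continuous (landauDensity m) := by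
  rw [funext (landauDensity_eq m)]
  fun_prop

lemma landauDensity_le_one (ζ : ℂ) : landauDensity m ζ ≤ 1 := by
  have hpow : ‖ζ‖ ^ (2 * m) * Real.exp (-‖ζ‖ ^ 2) ≤ m.factorial := by
    have h := Real.pow_div_factorial_le_exp (‖ζ‖ ^ 2) (by positivity) m
    rw [div_le_iff₀ (by positivity), ← pow_mul] at h
    rwa [Real.exp_neg, ← div_eq_mul_inv, div_le_iff₀ (Real.exp_pos _), mul_comm (m.factorial : ℝ)]
  rw [landauDensity_eq, inv_mul_le_iff₀ (by positivity), mul_one]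
  exact hpow.trans (le_mul_of_one_le_left (by positivity) (by linarith [Real.pi_gt_three]))

lemma integrable_norm_rpow_mul_exp_neg_norm_sq {q : ℝ} (hq : -2 < q) :
    Integrable fun ζ : ℂ => ‖ζ‖ ^ q * Real.exp (-‖ζ‖ ^ 2) := by
  have h := Complex.integral_rpow_mul_exp_neg_rpow (p := 2) (by norm_num) hq
  have hGamma : 0 < Real.Gamma ((q + 2) / 2) := Real.Gamma_pos_of_pos (by linarith)
  simp only [Real.rpow_two] at h
  exact .of_integral_ne_zero (by rw [h]; positivity)

lemma integrable_landauDensity : Integrable (landauDensity m) := by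
  have h := (integrable_norm_rpow_mul_exp_neg_norm_sq (q := (2 * m : ℕ))
    (by linarith [(2 * m).cast_nonneg (α := ℝ)])).const_mul (Real.pi * m.factorial)⁻¹
  simpa only [Real.rpow_natCast, ← landauDensity_eq] using h

lemma integral_landauDensity_pos : 0 < ∫ ζ, landauDensity m ζ := by
  refine integral_pos_of_integrable_nonneg_nonzero (x := 1) (continuous_landauDensity m)
    (integrable_landauDensity m) (landauDensity_nonneg m) ?_
  rw [landauDensity_eq, norm_one]
  positivity

lemma ae_norm_pos : ∀ᵐ ζ : ℂ, 0 < ‖ζ‖ :=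
  (Measure.ae_ne volume (0 : ℂ)).mono fun _ => norm_pos_iff.2

lemma isChargeDensity_landauDensity : IsChargeDensity volume (landauDensity m) (‖·‖) where
  measurable := (continuous_landauDensity m).measurable
  measurable_dist := measurable_norm
  nonneg := landauDensity_nonneg m
  ae_dist_pos := ae_norm_pos
  integrable := integrable_landauDensity m
  integrable_div_dist := by
    refine ((integrable_norm_rpow_mul_exp_neg_norm_sq (q := (2 * m : ℕ) - 1)
      (by linarith [(2 * m).cast_nonneg (α := ℝ)])).const_mul
        (Real.pi * m.factorial)⁻¹).congr ?_
    filter_upwards [ae_norm_pos] with ζ hζ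
    rw [Real.rpow_sub_one hζ.ne', Real.rpow_natCast, landauDensity_eq]
    ring

lemma inv_le_one_add_exp_one_mul {b : ℝ} (hb : 0 < b) :
    b⁻¹ ≤ 1 + Real.exp 1 * (b⁻¹ * Real.exp (-b ^ 2)) := by
  rcases le_total 1 b with h | h
  · exact (inv_le_one_of_one_le₀ h).trans (le_add_of_nonneg_right (by positivity))
  · have hexp : 1 ≤ Real.exp 1 * Real.exp (-b ^ 2) := by
      rw [← Real.exp_add]
      exact Real.one_le_exp (by nlinarith)
    calc b⁻¹ ≤ b⁻¹ * (Real.exp 1 * Real.exp (-b ^ 2)) := le_mul_of_one_le_right (by positivity) hexp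
      _ ≤ 1 + Real.exp 1 * (b⁻¹ * Real.exp (-b ^ 2)) := by linarith

lemma ae_norm_sub_pos : ∀ᵐ p : ℂ × ℂ, 0 < ‖p.1 - p.2‖ :=
  (quasiMeasurePreserving_sub (volume : Measure ℂ) volume).ae ae_norm_pos

lemma integrable_landauDensity_mul_landauDensity_div_norm_sub :
    Integrable fun p : ℂ × ℂ => landauDensity m p.1 * landauDensity m' p.2 / ‖p.1 - p.2‖ := by
  have hprod := (integrable_landauDensity m).mul_prod (integrable_landauDensity m')
  have hconv := (integrable_landauDensity m').convolution_integrand (ContinuousLinearMap.mul ℝ ℝ)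
    ((integrable_norm_rpow_mul_exp_neg_norm_sq (q := -1) (by norm_num)).const_mul (Real.exp 1))
  refine (hprod.add hconv).mono' (Measurable.aestronglyMeasurable (by fun_prop)) ?_
  filter_upwards [ae_norm_sub_pos] with p hp
  have h₁ := landauDensity_nonneg m p.1
  have h₂ := landauDensity_nonneg m' p.2
  simp only [Pi.add_apply, ContinuousLinearMap.mul_apply', Real.rpow_neg_one]
  rw [Real.norm_of_nonneg (by positivity)]
  set K := Real.exp 1 * (‖p.1 - p.2‖⁻¹ * Real.exp (-‖p.1 - p.2‖ ^ 2))
  calc landauDensity m p.1 * landauDensity m' p.2 / ‖p.1 - p.2‖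
      ≤ landauDensity m p.1 * landauDensity m' p.2 * (1 + K) := by
        rw [div_eq_mul_inv]
        gcongr
        exact inv_le_one_add_exp_one_mul hp
    _ = landauDensity m p.1 * landauDensity m' p.2
          + landauDensity m p.1 * (landauDensity m' p.2 * K) := by ring
    _ ≤ landauDensity m p.1 * landauDensity m' p.2 + landauDensity m' p.2 * K :=
        add_le_add le_rfl (mul_le_of_le_one_left (by positivity) (landauDensity_le_one m p.1))

lemma isChargeDensity_landauDensity_mul :
    IsChargeDensity volume (fun p : ℂ × ℂ => landauDensity m p.1 * landauDensity m' p.2)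
      (fun p => ‖p.1 - p.2‖) where
  measurable := by fun_prop
  measurable_dist := by fun_prop
  nonneg p := mul_nonneg (landauDensity_nonneg m p.1) (landauDensity_nonneg m' p.2)
  ae_dist_pos := ae_norm_sub_pos
  integrable := (integrable_landauDensity m).mul_prod (integrable_landauDensity m')
  integrable_div_dist := integrable_landauDensity_mul_landauDensity_div_norm_sub m m'

lemma exists_isAttraction_V : ∃ C, IsAttraction (V m) C :=
  ⟨_, (isChargeDensity_landauDensity m).isAttraction⟩

lemma exists_isRepulsion_W : ∃ c, IsRepulsion (W m m') c :=
  ⟨_, (isChargeDensity_landauDensity_mul m m').isRepulsion <| by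
    have h : (∫ p : ℂ × ℂ, landauDensity m p.1 * landauDensity m' p.2)
        = (∫ ζ, landauDensity m ζ) * ∫ ζ, landauDensity m' ζ := integral_prod_mul _ _
    rw [h]
    exact mul_pos (integral_landauDensity_pos m) (integral_landauDensity_pos m')⟩

lemma WLower_eq_coulombPotential :
    WLower m = coulombPotential volume (landauDensity (2 * m)) (fun ζ => √2 * ‖ζ‖) := by
  funext u
  rw [WLower, V, ← integral_const_mul]
  refine integral_congr_ae (ae_of_all _ fun ζ => ?_)
  have hscale : u ^ 2 + (√2 * ‖ζ‖) ^ 2 = 2 * ((u / √2) ^ 2 + ‖ζ‖ ^ 2) := by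
    rw [mul_pow, div_pow, Real.sq_sqrt zero_le_two]
    ring
  simp only [hscale, landauDensity, Real.sqrt_mul zero_le_two]
  rw [inv_mul_eq_div, div_mul_eq_div_div_swap]

lemma exists_isRepulsion_WLower : ∃ c, IsRepulsion (WLower m) c := by
  rw [WLower_eq_coulombPotential]
  exact ⟨_, ((isChargeDensity_landauDensity (2 * m)).const_mul_dist (by positivity)).isRepulsion
    (integral_landauDensity_pos (2 * m))⟩

end LandauDensity

section PartialDeriv

variable {n : ℕ} {E : Type*} [NormedAddCommGroup E] [NormedSpace ℝ E]

/-- The partial derivative `∂f/∂x_j`, encoded like `secondPartial` as a derivative along the line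
on which only the coordinate `j` varies. -/
def partialDeriv (j : Fin n) (f : (Fin n → ℝ) → E) (x : Fin n → ℝ) : E :=
  deriv (fun t => f (Function.update x j t)) (x j)

lemma hasDerivAt_comp_update {f : (Fin n → ℝ) → E} (hf : Differentiable ℝ f) (j : Fin n)
    (x : Fin n → ℝ) (t : ℝ) :
    HasDerivAt (fun s => f (Function.update x j s))
      (fderiv ℝ f (Function.update x j t) (Pi.single j 1)) t :=
  (hf _).hasFDerivAt.comp_hasDerivAt t (hasDerivAt_update x j t)

lemma partialDeriv_eq_fderiv {f : (Fin n → ℝ) → E} (hf : Differentiable ℝ f) (j : Fin n)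
    (x : Fin n → ℝ) : partialDeriv j f x = fderiv ℝ f x (Pi.single j 1) := by
  rw [partialDeriv, (hasDerivAt_comp_update hf j x (x j)).deriv, Function.update_eq_self]

lemma hasDerivAt_partialDeriv {f : (Fin n → ℝ) → E} (hf : Differentiable ℝ f) (j : Fin n)
    (x : Fin n → ℝ) :
    HasDerivAt (fun s => f (Function.update x j s)) (partialDeriv j f x) (x j) :=
  (hasDerivAt_comp_update hf j x (x j)).differentiableAt.hasDerivAt

lemma partialDeriv_const_smul {f : (Fin n → ℝ) → E} (hf : Differentiable ℝ f) (a : ℝ) (j : Fin n)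
    (x : Fin n → ℝ) : partialDeriv j (fun x => a • f x) x = a • partialDeriv j f x :=
  ((hasDerivAt_partialDeriv hf j x).const_smul a).deriv

lemma partialDeriv_smul {g : (Fin n → ℝ) → ℝ} {f : (Fin n → ℝ) → E} (hg : Differentiable ℝ g)
    (hf : Differentiable ℝ f) (j : Fin n) (x : Fin n → ℝ) :
    partialDeriv j (fun x => g x • f x) x
      = g x • partialDeriv j f x + partialDeriv j g x • f x := by
  simpa only [Function.update_eq_self] using!
    ((hasDerivAt_partialDeriv hg j x).smul (hasDerivAt_partialDeriv hf j x)).deriv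

lemma partialDeriv_conj {f : (Fin n → ℝ) → ℂ} (hf : Differentiable ℝ f) (j : Fin n)
    (x : Fin n → ℝ) : partialDeriv j (fun x => conj (f x)) x = conj (partialDeriv j f x) :=
  ((Complex.conjCLE : ℂ →L[ℝ] ℂ).hasFDerivAt.comp_hasDerivAt (x j)
    (hasDerivAt_partialDeriv hf j x)).deriv

lemma contDiff_partialDeriv {f : (Fin n → ℝ) → E} (hf : ContDiff ℝ ∞ f) (j : Fin n) :
    ContDiff ℝ ∞ (partialDeriv j f) := by
  rw [funext (partialDeriv_eq_fderiv (hf.differentiable (by simp)) j)]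
  exact (hf.fderiv_right (m := ∞) (by simp)).clm_apply contDiff_const

lemma hasCompactSupport_partialDeriv {f : (Fin n → ℝ) → E} (hf : Differentiable ℝ f)
    (hc : HasCompactSupport f) (j : Fin n) : HasCompactSupport (partialDeriv j f) := by
  rw [funext (partialDeriv_eq_fderiv hf j)]
  exact hc.fderiv_apply ℝ _

lemma secondPartial_eq_partialDeriv {f : (Fin n → ℝ) → ℂ} (hf : Differentiable ℝ f) (j : Fin n)
    (x : Fin n → ℝ) : secondPartial j f x = partialDeriv j (partialDeriv j f) x := by
  rw [secondPartial, iteratedDeriv_succ, iteratedDeriv_one, partialDeriv]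
  congr 1
  funext t
  rw [(hasDerivAt_comp_update hf j x t).deriv, partialDeriv_eq_fderiv hf]

lemma integral_mul_partialDeriv {𝕜 : Type*} [RCLike 𝕜] {f g : (Fin n → ℝ) → 𝕜}
    (hf : ContDiff ℝ ∞ f) (hg : ContDiff ℝ ∞ g)
    (hc : HasCompactSupport g) (j : Fin n) :
    ∫ x, f x * partialDeriv j g x = -∫ x, partialDeriv j f x * g x := by
  have hdf : Differentiable ℝ f := hf.differentiable (by simp)
  have hdg : Differentiable ℝ g := hg.differentiable (by simp)
  have hf' := (contDiff_partialDeriv hf j).continuous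
  have hg' := (contDiff_partialDeriv hg j).continuous
  have hi₁ : Integrable fun x => partialDeriv j f x * g x :=
    (hf'.mul hg.continuous).integrable_of_hasCompactSupport hc.mul_left
  have hi₂ : Integrable fun x => f x * partialDeriv j g x :=
    (hf.continuous.mul hg').integrable_of_hasCompactSupport
      (hasCompactSupport_partialDeriv hdg hc j).mul_left
  have hi₃ : Integrable fun x => f x * g x :=
    (hf.continuous.mul hg.continuous).integrable_of_hasCompactSupport hc.mul_left
  simp only [partialDeriv_eq_fderiv hdf, partialDeriv_eq_fderiv hdg] at hi₁ hi₂ ⊢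
  exact integral_mul_fderiv_eq_neg_fderiv_mul_of_integrable hi₁ hi₂ hi₃ (fun x _ => hdf x)
    fun x _ => hdg x

lemma integral_partialDeriv_eq_zero {𝕜 : Type*} [RCLike 𝕜] {g : (Fin n → ℝ) → 𝕜}
    (hg : ContDiff ℝ ∞ g) (hc : HasCompactSupport g) (j : Fin n) :
    ∫ x, partialDeriv j g x = 0 := by
  simpa only [one_mul, partialDeriv, deriv_const, zero_mul, integral_zero, neg_zero] using
    integral_mul_partialDeriv (contDiff_const (c := (1 : 𝕜))) hg hc j

lemma integrable_partialDeriv {f : (Fin n → ℝ) → E} (hf : ContDiff ℝ ∞ f)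
    (hc : HasCompactSupport f) (j : Fin n) : Integrable (partialDeriv j f) :=
  (contDiff_partialDeriv hf j).continuous.integrable_of_hasCompactSupport
    (hasCompactSupport_partialDeriv (hf.differentiable (by simp)) hc j)

lemma partialDeriv_comp_insertNth (f : (Fin (n + 1) → ℝ) → E) (k : Fin (n + 1)) (t : ℝ)
    (i : Fin n) (y : Fin n → ℝ) :
    partialDeriv i (fun y => f (k.insertNth t y)) y
      = partialDeriv (k.succAbove i) f (k.insertNth t y) := by
  simp only [partialDeriv, Fin.insertNth_update, Fin.insertNth_apply_succAbove]

lemma contDiff_insertNth (k : Fin (n + 1)) (t : ℝ) :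
    ContDiff ℝ ∞ fun y : Fin n → ℝ => (k.insertNth t y : Fin (n + 1) → ℝ) := by
  refine contDiff_pi.2 ((Fin.forall_iff_succAbove k).2 ⟨?_, fun i => ?_⟩)
  · simpa using! contDiff_const
  · simpa using! contDiff_apply ℝ ℝ i

lemma hasCompactSupport_comp_insertNth {α : Type*} [Zero α] {f : (Fin (n + 1) → ℝ) → α}
    (hc : HasCompactSupport f) (k : Fin (n + 1)) (t : ℝ) :
    HasCompactSupport fun y : Fin n → ℝ => f (k.insertNth t y) := by
  refine HasCompactSupport.intro (K := k.removeNth '' tsupport f)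
    (hc.isCompact.image (continuous_pi fun i => continuous_apply _)) fun y hy => ?_
  by_contra h
  exact hy ⟨_, subset_tsupport f h, Fin.removeNth_insertNth _ _ _⟩

lemma integral_nonneg_of_insertNth {f : (Fin (n + 1) → ℝ) → ℝ} (hf : Integrable f)
    (k : Fin (n + 1)) (h : ∀ t, 0 ≤ ∫ y : Fin n → ℝ, f (k.insertNth t y)) : 0 ≤ ∫ x, f x := by
  have hm := (volume_preserving_piFinSuccAbove (fun _ : Fin (n + 1) => ℝ) k).symm
  have hi := (hm.integrable_comp_emb (MeasurableEquiv.measurableEmbedding _)).2 hf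
  rw [← hm.integral_comp (MeasurableEquiv.measurableEmbedding _)]
  exact (integral_prod _ hi).symm ▸ integral_nonneg h

end PartialDeriv

section Energy

variable {n : ℕ} {E : Type*} [NormedAddCommGroup E]

lemma IsBoundedMeasurable.sub_const {X : Type*} [MeasurableSpace X] {U : X → ℝ}
    (hU : IsBoundedMeasurable U) (e : ℝ) : IsBoundedMeasurable fun x => U x - e := by
  obtain ⟨D, hD⟩ := hU.exists_abs_le
  exact ⟨hU.measurable.sub_const e, D + |e|,
    fun x => (abs_sub _ _).trans (add_le_add_left (hD x) _)⟩

lemma hasCompactSupport_norm_sq {φ : (Fin n → ℝ) → E} (hc : HasCompactSupport φ) :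
    HasCompactSupport fun x => ‖φ x‖ ^ 2 :=
  hc.comp_left (g := fun z : E => ‖z‖ ^ 2) (by simp)

lemma integrable_norm_sq {φ : (Fin n → ℝ) → E} (hφ : Continuous φ) (hc : HasCompactSupport φ) :
    Integrable fun x => ‖φ x‖ ^ 2 :=
  (hφ.norm.pow 2).integrable_of_hasCompactSupport (hasCompactSupport_norm_sq hc)

lemma IsBoundedMeasurable.integrable_mul {U f : (Fin n → ℝ) → ℝ} (hU : IsBoundedMeasurable U)
    (hf : Continuous f) (hc : HasCompactSupport f) : Integrable fun x => U x * f x := by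
  obtain ⟨D, hD⟩ := hU.exists_abs_le
  exact (hf.integrable_of_hasCompactSupport hc).bdd_mul hU.measurable.aestronglyMeasurable
    (ae_of_all _ hD)

variable [NormedSpace ℝ E]

/-- The energy density of the wave function `φ` in the potential `U`, with the coefficient `K` of
the kinetic term, after an integration by parts has distributed the second derivatives. -/
def energyDensity (U : (Fin n → ℝ) → ℝ) (K : ℝ) (φ : (Fin n → ℝ) → E) (x : Fin n → ℝ) : ℝ :=
  K * ∑ j, ‖partialDeriv j φ x‖ ^ 2 + U x * ‖φ x‖ ^ 2

lemma integrable_energyDensity {U : (Fin n → ℝ) → ℝ} (hU : IsBoundedMeasurable U) (K : ℝ)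
    {φ : (Fin n → ℝ) → E} (hφ : ContDiff ℝ ∞ φ) (hc : HasCompactSupport φ) :
    Integrable (energyDensity U K φ) :=
  .add (.const_mul (integrable_finsetSum _ fun j _ =>
      integrable_norm_sq (contDiff_partialDeriv hφ j).continuous
        (hasCompactSupport_partialDeriv (hφ.differentiable (by simp)) hc j)) K)
    (hU.integrable_mul (hφ.continuous.norm.pow 2) (hasCompactSupport_norm_sq hc))

lemma energyDensity_const_smul (U : (Fin n → ℝ) → ℝ) (K a : ℝ) {φ : (Fin n → ℝ) → E}
    (hφ : Differentiable ℝ φ) (x : Fin n → ℝ) :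
    energyDensity U K (fun x => a • φ x) x = a ^ 2 * energyDensity U K φ x := by
  simp only [energyDensity, partialDeriv_const_smul hφ, norm_smul, mul_pow, Real.norm_eq_abs,
    sq_abs, ← Finset.mul_sum]
  ring

lemma integral_energyDensity_sub_const {U : (Fin n → ℝ) → ℝ} (hU : IsBoundedMeasurable U)
    (K e : ℝ) {φ : (Fin n → ℝ) → E} (hφ : ContDiff ℝ ∞ φ) (hc : HasCompactSupport φ) :
    ∫ x, energyDensity (fun x => U x - e) K φ x
      = (∫ x, energyDensity U K φ x) - e * ∫ x, ‖φ x‖ ^ 2 := by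
  rw [← integral_const_mul, ← integral_sub (integrable_energyDensity hU K hφ hc)
    ((integrable_norm_sq hφ.continuous hc).const_mul e)]
  congr 1
  funext x
  simp only [energyDensity]
  ring

/-- The potential energy of `n` electrons at the points `x`. -/
def potential (v w : ℝ → ℝ) (Z : ℝ) (x : Fin n → ℝ) : ℝ :=
  -(Z * ∑ j, v (x j)) + ∑ j, ∑ k ∈ Finset.Ioi j, w |x j - x k|

variable {v w : ℝ → ℝ}

lemma isBoundedMeasurable_potential (hv : IsBoundedMeasurable v) (hw : IsBoundedMeasurable w)
    (Z : ℝ) : IsBoundedMeasurable (potential v w Z : (Fin n → ℝ) → ℝ) := by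
  obtain ⟨A, hA⟩ := hv.exists_abs_le
  obtain ⟨D, hD⟩ := hw.exists_abs_le
  have := hv.measurable
  have := hw.measurable
  refine ⟨by unfold potential; fun_prop,
    |Z| * ∑ _j : Fin n, A + ∑ j : Fin n, ∑ _k ∈ Finset.Ioi j, D, fun x => ?_⟩
  refine (abs_add_le _ _).trans (add_le_add ?_ ?_)
  · rw [abs_neg, abs_mul]
    gcongr
    exact (Finset.abs_sum_le_sum_abs _ _).trans (Finset.sum_le_sum fun j _ => hA _)
  · refine (Finset.abs_sum_le_sum_abs _ _).trans (Finset.sum_le_sum fun j _ => ?_)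
    exact (Finset.abs_sum_le_sum_abs _ _).trans (Finset.sum_le_sum fun k _ => hD _)

lemma integral_conj_mul_partialDeriv_partialDeriv {φ : (Fin n → ℝ) → ℂ} (hφ : ContDiff ℝ ∞ φ)
    (hc : HasCompactSupport φ) (j : Fin n) :
    ∫ x, conj (φ x) * partialDeriv j (partialDeriv j φ) x
      = -((∫ x, ‖partialDeriv j φ x‖ ^ 2 : ℝ) : ℂ) := by
  have hd : Differentiable ℝ φ := hφ.differentiable (by simp)
  have hconj : ContDiff ℝ ∞ fun x => conj (φ x) :=
    (Complex.conjCLE : ℂ →L[ℝ] ℂ).contDiff.comp hφ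
  rw [integral_mul_partialDeriv hconj (contDiff_partialDeriv hφ j)
    (hasCompactSupport_partialDeriv hd hc j), ← integral_complex_ofReal]
  simp only [partialDeriv_conj hd, Complex.conj_mul', Complex.ofReal_pow]

lemma hamiltonian_eq {φ : (Fin n → ℝ) → ℂ} (hφ : Differentiable ℝ φ) (Z M : ℝ)
    (x : Fin n → ℝ) :
    hamiltonian v w n Z M φ x
      = -((1 / M : ℝ) : ℂ) * ∑ j, partialDeriv j (partialDeriv j φ) x
        + ((potential v w Z x : ℝ) : ℂ) * φ x := by
  simp only [hamiltonian, potential, secondPartial_eq_partialDeriv hφ, Finset.sum_sub_distrib,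
    ← Finset.mul_sum, ← Finset.sum_mul]
  push_cast
  rw [← Finset.mul_sum]
  ring

lemma integral_conj_mul_hamiltonian (hv : IsBoundedMeasurable v) (hw : IsBoundedMeasurable w)
    (Z M : ℝ) {φ : (Fin n → ℝ) → ℂ} (hφ : ContDiff ℝ ∞ φ) (hc : HasCompactSupport φ) :
    ∫ x, conj (φ x) * hamiltonian v w n Z M φ x
      = ((∫ x, energyDensity (potential v w Z) (1 / M) φ x : ℝ) : ℂ) := by
  have hd : Differentiable ℝ φ := hφ.differentiable (by simp)
  have hkin (j : Fin n) :
      Integrable fun x => conj (φ x) * partialDeriv j (partialDeriv j φ) x :=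
    ((Complex.continuous_conj.comp hφ.continuous).mul
      (contDiff_partialDeriv (contDiff_partialDeriv hφ j) j).continuous)
      |>.integrable_of_hasCompactSupport (hc.comp_left (map_zero _)).mul_right
  have hsq (j : Fin n) : Integrable fun x => ‖partialDeriv j φ x‖ ^ 2 :=
    integrable_norm_sq (contDiff_partialDeriv hφ j).continuous
      (hasCompactSupport_partialDeriv hd hc j)
  have hpot : Integrable fun x => potential v w Z x * ‖φ x‖ ^ 2 :=
    (isBoundedMeasurable_potential hv hw Z).integrable_mul (hφ.continuous.norm.pow 2)
      (hasCompactSupport_norm_sq hc)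
  have hpoint (x : Fin n → ℝ) : conj (φ x) * hamiltonian v w n Z M φ x
      = -((1 / M : ℝ) : ℂ) * ∑ j, conj (φ x) * partialDeriv j (partialDeriv j φ) x
        + ((potential v w Z x * ‖φ x‖ ^ 2 : ℝ) : ℂ) := by
    rw [hamiltonian_eq hd, ← Finset.mul_sum, Complex.ofReal_mul, Complex.ofReal_pow,
      ← Complex.conj_mul']
    ring
  simp only [hpoint, energyDensity]
  have hpot' : Integrable fun x => ((potential v w Z x * ‖φ x‖ ^ 2 : ℝ) : ℂ) := hpot.ofReal
  rw [integral_add (.const_mul (integrable_finsetSum _ fun j _ => hkin j) _) hpot',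
    integral_add (.const_mul (integrable_finsetSum _ fun j _ => hsq j) _) hpot,
    integral_const_mul, integral_const_mul, integral_finsetSum _ fun j _ => hkin j,
    integral_finsetSum _ fun j _ => hsq j, integral_complex_ofReal]
  simp only [integral_conj_mul_partialDeriv_partialDeriv hφ hc, Finset.sum_neg_distrib]
  push_cast
  ring

lemma coe_le_groundEnergy_iff (hv : IsBoundedMeasurable v) (hw : IsBoundedMeasurable w)
    {Z M e : ℝ} :
    (e : EReal) ≤ groundEnergy v w n Z M ↔ ∀ φ : (Fin n → ℝ) → ℂ, ContDiff ℝ ∞ φ →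
      HasCompactSupport φ →
        0 ≤ ∫ x, energyDensity (fun x => potential v w Z x - e) (1 / M) φ x := by
  have hU : IsBoundedMeasurable (potential v w Z : (Fin n → ℝ) → ℝ) :=
    isBoundedMeasurable_potential hv hw Z
  have htrial {φ : (Fin n → ℝ) → ℂ} (hφ : IsTrial φ) :
      (e : EReal) ≤ ((∫ x, conj (φ x) * hamiltonian v w n Z M φ x).re : ℝ) ↔
        0 ≤ ∫ x, energyDensity (fun x => potential v w Z x - e) (1 / M) φ x := by
    rw [EReal.coe_le_coe_iff, integral_conj_mul_hamiltonian hv hw Z M hφ.smooth hφ.compactSupport,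
      Complex.ofReal_re, integral_energyDensity_sub_const hU _ _ hφ.smooth hφ.compactSupport,
      hφ.normalized, mul_one, sub_nonneg]
  rw [groundEnergy, le_iInf₂_iff]
  refine ⟨fun h φ hφ hc => ?_, fun h φ hφ => (htrial hφ).2 (h φ hφ.smooth hφ.compactSupport)⟩
  by_cases hzero : φ = 0
  · simp [hzero, energyDensity, partialDeriv]
  obtain ⟨x₀, hx₀⟩ := Function.ne_iff.1 hzero
  have hpos : 0 < ∫ x, ‖φ x‖ ^ 2 :=
    (hφ.continuous.norm.pow 2).integral_pos_of_hasCompactSupport_nonneg_nonzero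
      (hasCompactSupport_norm_sq hc) (fun x => by positivity) (x := x₀)
      (pow_ne_zero 2 (norm_ne_zero_iff.2 hx₀))
  set a := (√(∫ x, ‖φ x‖ ^ 2))⁻¹
  have ha : a ^ 2 = (∫ x, ‖φ x‖ ^ 2)⁻¹ := by rw [inv_pow, Real.sq_sqrt hpos.le]
  have hnormalized : IsTrial fun x => a • φ x := by
    refine ⟨by fun_prop, hc.smul_left (f := fun _ => a), ?_⟩
    simp only [norm_smul, mul_pow, Real.norm_eq_abs, sq_abs, integral_const_mul, ha,
      inv_mul_cancel₀ hpos.ne']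
  have hscaled := (htrial hnormalized).1 (h _ hnormalized)
  simp only [energyDensity_const_smul _ _ _ (hφ.differentiable (by simp)), integral_const_mul, ha]
    at hscaled
  exact nonneg_of_mul_nonneg_right hscaled (inv_pos.2 hpos)

end Energy

section Sums

variable {n : ℕ}

lemma sum_sum_Ioi_eq_add_sum_succAbove {A : Type*} [AddCommMonoid A]
    {a : Fin (n + 1) → Fin (n + 1) → A} (ha : ∀ j l, a j l = a l j) (k : Fin (n + 1)) :
    ∑ j, ∑ l ∈ Finset.Ioi j, a j l
      = (∑ i, ∑ l ∈ Finset.Ioi i, a (k.succAbove i) (k.succAbove l))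
        + ∑ i, a k (k.succAbove i) := by
  have hfilter {m : ℕ} (f : Fin m → Fin m → A) :
      ∑ j, ∑ l ∈ Finset.Ioi j, f j l = ∑ j, ∑ l, if j < l then f j l else 0 := by
    simp only [← Finset.sum_filter, Finset.filter_lt_eq_Ioi]
  have hpair (i : Fin n) : ((if k < k.succAbove i then a k (k.succAbove i) else 0)
      + if k.succAbove i < k then a (k.succAbove i) k else 0) = a k (k.succAbove i) := by
    rcases lt_or_gt_of_ne (Fin.succAbove_ne k i) with h | h
    · rw [if_neg h.not_gt, if_pos h, zero_add, ha]
    · rw [if_pos h, if_neg h.not_gt, add_zero]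
  simp only [hfilter, Fin.sum_univ_succAbove _ k, lt_irrefl, if_false, zero_add,
    Finset.sum_add_distrib, Fin.succAbove_lt_succAbove_iff]
  rw [← add_assoc, ← Finset.sum_add_distrib, Finset.sum_congr rfl fun i _ => hpair i, add_comm]

lemma sum_sum_succAbove_comm {A : Type*} [AddCommGroup A] (a : Fin (n + 1) → Fin (n + 1) → A) :
    ∑ k, ∑ i : Fin n, a k (k.succAbove i) = ∑ k, ∑ i : Fin n, a (k.succAbove i) k := by
  have hsplit (b : Fin (n + 1) → Fin (n + 1) → A) :
      ∑ k, ∑ i : Fin n, b k (k.succAbove i) = ∑ k, ∑ j, b k j - ∑ k, b k k := by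
    rw [← Finset.sum_sub_distrib]
    exact Finset.sum_congr rfl fun k _ => by rw [Fin.sum_univ_succAbove _ k, add_sub_cancel_left]
  rw [hsplit, hsplit fun k j => a j k, Finset.sum_comm]

lemma potential_eq_add_removeNth (v w : ℝ → ℝ) (Z : ℝ) (x : Fin (n + 1) → ℝ) (k : Fin (n + 1)) :
    potential v w Z x = potential v w Z (k.removeNth x)
      + (-(Z * v (x k)) + ∑ i, w |x k - x (k.succAbove i)|) := by
  have hsymm (j l : Fin (n + 1)) : w |x j - x l| = w |x l - x j| := by rw [abs_sub_comm]
  simp only [potential, sum_sum_Ioi_eq_add_sum_succAbove hsymm k, Fin.sum_univ_succAbove _ k,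
    Fin.removeNth_apply]
  ring

end Sums

section Weight

/-- The weight `√(R² + x²)` put on each electron: constant up to the scale `R` and comparable to
`|x|` beyond it. -/
def weight (R x : ℝ) : ℝ := √(R ^ 2 + x ^ 2)

/-- A bounded function whose derivative approximates `(1 + x²)^{-1/2}` up to the scale `R`. -/
def arsinhDiff (R x : ℝ) : ℝ := Real.arsinh x - Real.arsinh (x / R)

variable {R : ℝ}

lemma le_weight (R x : ℝ) : R ≤ weight R x :=
  Real.le_sqrt_of_sq_le (by nlinarith [sq_nonneg x])

lemma weight_pos (hR : 0 < R) (x : ℝ) : 0 < weight R x := hR.trans_le (le_weight R x)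

lemma abs_le_weight (R x : ℝ) : |x| ≤ weight R x :=
  Real.abs_le_sqrt (by nlinarith [sq_nonneg R])

lemma weight_le_add_abs (hR : 0 ≤ R) (x : ℝ) : weight R x ≤ R + |x| := by
  rw [weight, Real.sqrt_le_left (by positivity), ← sq_abs x]
  nlinarith [abs_nonneg x]

lemma weight_eq_mul_sqrt (hR : 0 < R) (x : ℝ) : weight R x = R * √(1 + (x / R) ^ 2) := by
  have hsq : R ^ 2 + x ^ 2 = R ^ 2 * (1 + (x / R) ^ 2) := by field_simp
  rw [weight, hsq, Real.sqrt_mul (sq_nonneg R), Real.sqrt_sq hR.le]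

lemma contDiff_weight (hR : 0 < R) : ContDiff ℝ ∞ (weight R) :=
  ContDiff.sqrt (by fun_prop) fun x => by positivity

lemma hasDerivAt_weight (hR : 0 < R) (x : ℝ) :
    HasDerivAt (weight R) (x / weight R x) x := by
  have hne : R ^ 2 + x ^ 2 ≠ 0 := by positivity
  refine (((hasDerivAt_pow 2 x).const_add (R ^ 2)).sqrt hne).congr_deriv ?_
  rw [Nat.cast_ofNat, pow_one, mul_div_mul_left _ _ two_ne_zero, weight]

lemma abs_div_weight_le_one (hR : 0 < R) (x : ℝ) : |x / weight R x| ≤ 1 := by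
  rw [abs_div, abs_of_pos (weight_pos hR x), div_le_one (weight_pos hR x)]
  exact abs_le_weight R x

lemma contDiff_arsinhDiff (R : ℝ) : ContDiff ℝ ∞ (arsinhDiff R) :=
  Real.contDiff_arsinh.sub (ContDiff.arsinh (by fun_prop))

lemma hasDerivAt_arsinhDiff (hR : 0 < R) (x : ℝ) :
    HasDerivAt (arsinhDiff R) ((√(1 + x ^ 2))⁻¹ - (weight R x)⁻¹) x := by
  refine ((Real.hasDerivAt_arsinh x).sub ((hasDerivAt_id x).div_const R).arsinh).congr_deriv ?_
  rw [weight_eq_mul_sqrt hR, mul_inv, smul_eq_mul, one_div, mul_comm R⁻¹, id]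

lemma abs_arsinhDiff (hR : 1 ≤ R) (x : ℝ) : |arsinhDiff R x| = arsinhDiff R |x| := by
  have hnonneg {y : ℝ} (hy : 0 ≤ y) : 0 ≤ arsinhDiff R y :=
    sub_nonneg.2 (Real.arsinh_le_arsinh.2 (div_le_self hy hR))
  rcases le_total 0 x with hx | hx
  · rw [abs_of_nonneg hx, abs_of_nonneg (hnonneg hx)]
  · have hodd : arsinhDiff R (-x) = -arsinhDiff R x := by
      simp only [arsinhDiff, neg_div, Real.arsinh_neg]
      ring
    rw [abs_of_nonpos hx, ← abs_of_nonneg (hnonneg (neg_nonneg.2 hx)), hodd, abs_neg]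

lemma abs_arsinhDiff_le_log (hR : 1 ≤ R) (x : ℝ) : |arsinhDiff R x| ≤ Real.log R := by
  have hR0 : 0 < R := by linarith
  rw [abs_arsinhDiff hR, arsinhDiff, sub_le_iff_le_add, ← Real.exp_le_exp, Real.exp_add,
    Real.exp_log hR0, Real.exp_arsinh, Real.exp_arsinh, mul_add, mul_div_cancel₀ _ hR0.ne',
    ← weight_eq_mul_sqrt hR0]
  refine add_le_add_right (Real.sqrt_le_sqrt ?_) _
  exact add_le_add_left (one_le_pow₀ hR) _

lemma weight_mul_le (hR : 0 < R) {C x y : ℝ} (hC : 0 ≤ C) (hy : y ≤ C / √(1 + x ^ 2)) :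
    weight R x * y ≤ C * (R * ((√(1 + x ^ 2))⁻¹ - (weight R x)⁻¹) + 2) := by
  have hinv : |x| * (√(1 + x ^ 2))⁻¹ ≤ 1 := by
    rw [← div_eq_mul_inv, div_le_one (by positivity)]
    exact Real.abs_le_sqrt (by linarith)
  have hinv_weight : R * (weight R x)⁻¹ ≤ 1 := by
    rw [← div_eq_mul_inv, div_le_one (weight_pos hR x)]
    exact le_weight R x
  calc weight R x * y ≤ weight R x * (C / √(1 + x ^ 2)) :=
        mul_le_mul_of_nonneg_left hy (weight_pos hR x).le
    _ ≤ (R + |x|) * (C / √(1 + x ^ 2)) :=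
        mul_le_mul_of_nonneg_right (weight_le_add_abs hR.le x) (by positivity)
    _ = C * (R * (√(1 + x ^ 2))⁻¹ + |x| * (√(1 + x ^ 2))⁻¹) := by ring
    _ ≤ C * (R * ((√(1 + x ^ 2))⁻¹ - (weight R x)⁻¹) + 2) :=
        mul_le_mul_of_nonneg_left (by linarith) hC

lemma half_le_weight_add_weight_div (hR : 1 ≤ R) (x y : ℝ) :
    1 / 2 ≤ (weight R x + weight R y) / (1 + |x - y|) := by
  rw [le_div_iff₀ (by positivity)]
  linarith [le_weight R x, le_weight R y, abs_le_weight R x, abs_le_weight R y, abs_sub x y]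

end Weight

section GroundStateSubstitution

variable {n : ℕ} {E : Type*} [NormedAddCommGroup E] [InnerProductSpace ℝ E]

lemma mul_norm_sq_add_le_norm_sq_partialDeriv_sqrt_smul {G : (Fin n → ℝ) → ℝ}
    {ψ : (Fin n → ℝ) → E} (hG : Differentiable ℝ G) (hpos : ∀ x, 0 < G x)
    (hψ : Differentiable ℝ ψ) (j : Fin n) (x : Fin n → ℝ) :
    G x * ‖partialDeriv j ψ x‖ ^ 2 + partialDeriv j G x * inner ℝ (ψ x) (partialDeriv j ψ x)
      ≤ ‖partialDeriv j (fun x => √(G x) • ψ x) x‖ ^ 2 := by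
  have hsqrt : partialDeriv j (fun x => √(G x)) x = partialDeriv j G x / (2 * √(G x)) := by
    simpa only [Function.update_eq_self] using!
      ((hasDerivAt_partialDeriv hG j x).sqrt (by simpa using (hpos x).ne')).deriv
  have hne : √(G x) ≠ 0 := (Real.sqrt_pos.2 (hpos x)).ne'
  rw [partialDeriv_smul (hG.sqrt fun x => (hpos x).ne') hψ, norm_add_sq_real, norm_smul, mul_pow,
    Real.norm_eq_abs, sq_abs, Real.sq_sqrt (hpos x).le, hsqrt, inner_smul_left, inner_smul_right,
    real_inner_comm, RCLike.conj_to_real]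
  have hcross (a : ℝ) :
      2 * (√(G x) * (partialDeriv j G x / (2 * √(G x)) * a)) = partialDeriv j G x * a := by
    field_simp
  rw [hcross]
  exact le_add_of_nonneg_right (sq_nonneg _)

/-- The sum of the weights of the single electrons, the square of the function by which the wave
functions are multiplied in the ground-state substitution. -/
def totalWeight (R : ℝ) (x : Fin n → ℝ) : ℝ := ∑ k, weight R (x k)

variable {R : ℝ}

lemma totalWeight_pos (hR : 0 < R) (x : Fin (n + 1) → ℝ) : 0 < totalWeight R x :=
  Finset.sum_pos (fun _ _ => weight_pos hR _) Finset.univ_nonempty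

lemma contDiff_totalWeight (hR : 0 < R) :
    ContDiff ℝ ∞ (totalWeight R : (Fin n → ℝ) → ℝ) :=
  ContDiff.sum fun k _ => (contDiff_weight hR).comp (contDiff_apply ℝ ℝ k)

lemma partialDeriv_totalWeight (hR : 0 < R) (j : Fin n) (x : Fin n → ℝ) :
    partialDeriv j (totalWeight R) x = x j / weight R (x j) := by
  have hsummand (k : Fin n) : HasDerivAt (fun t => weight R (Function.update x j t k))
      (if k = j then x j / weight R (x j) else 0) (x j) := by
    split_ifs with hk
    · subst hk
      simpa only [Function.update_self] using hasDerivAt_weight hR (x k)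
    · simpa only [Function.update_of_ne hk] using hasDerivAt_const (x j) (weight R (x k))
  simpa only [Finset.sum_ite_eq', Finset.mem_univ, if_true] using!
    (HasDerivAt.fun_sum (u := Finset.univ) fun k _ => hsummand k).deriv

/-- The energy density, in the potential `U`, of the electrons other than the `k`-th one, whose
position is a parameter. -/
def reducedDensity (U : (Fin n → ℝ) → ℝ) (K : ℝ) (ψ : (Fin (n + 1) → ℝ) → E) (k : Fin (n + 1))
    (x : Fin (n + 1) → ℝ) : ℝ :=
  energyDensity U K (fun y => ψ (k.insertNth (x k) y)) (k.removeNth x)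

lemma reducedDensity_eq (U : (Fin n → ℝ) → ℝ) (K : ℝ) (ψ : (Fin (n + 1) → ℝ) → E)
    (k : Fin (n + 1)) (x : Fin (n + 1) → ℝ) :
    reducedDensity U K ψ k x = K * ∑ i, ‖partialDeriv (k.succAbove i) ψ x‖ ^ 2
      + U (k.removeNth x) * ‖ψ x‖ ^ 2 := by
  simp only [reducedDensity, energyDensity, partialDeriv_comp_insertNth,
    Fin.insertNth_self_removeNth]

/-- The part of the energy density of `√(totalWeight R) • ψ` that involves the kinetic energy and
the attraction of the `k`-th electron alone; the second summand comes from the derivative of the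
weight. -/
def oneBodyDensity (v : ℝ → ℝ) (Z K R : ℝ) (ψ : (Fin n → ℝ) → E) (k : Fin n)
    (x : Fin n → ℝ) : ℝ :=
  K * (weight R (x k) * ‖partialDeriv k ψ x‖ ^ 2
    + x k / weight R (x k) * inner ℝ (ψ x) (partialDeriv k ψ x))
    - Z * (weight R (x k) * v (x k)) * ‖ψ x‖ ^ 2

lemma sum_density_le_energyDensity_sqrt_totalWeight_smul (v w : ℝ → ℝ) (Z e : ℝ) {K : ℝ}
    (hR : 0 < R) (hK : 0 ≤ K) {ψ : (Fin (n + 1) → ℝ) → E} (hψ : Differentiable ℝ ψ)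
    (x : Fin (n + 1) → ℝ) :
    ∑ k, (weight R (x k) * reducedDensity (fun y => potential v w Z y - e) K ψ k x
        + oneBodyDensity v Z K R ψ k x
        + weight R (x k) * (∑ i, w |x k - x (k.succAbove i)|) * ‖ψ x‖ ^ 2)
      ≤ energyDensity (fun x => potential v w Z x - e) K (fun x => √(totalWeight R x) • ψ x) x := by
  have hkin (j : Fin (n + 1)) : totalWeight R x * ‖partialDeriv j ψ x‖ ^ 2
      + x j / weight R (x j) * inner ℝ (ψ x) (partialDeriv j ψ x)
      ≤ ‖partialDeriv j (fun x => √(totalWeight R x) • ψ x) x‖ ^ 2 := by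
    rw [← partialDeriv_totalWeight hR]
    exact mul_norm_sq_add_le_norm_sq_partialDeriv_sqrt_smul
      ((contDiff_totalWeight hR).differentiable (by simp)) (totalWeight_pos hR) hψ j x
  have hnorm : ‖√(totalWeight R x) • ψ x‖ ^ 2 = totalWeight R x * ‖ψ x‖ ^ 2 := by
    rw [norm_smul, mul_pow, Real.norm_eq_abs, sq_abs, Real.sq_sqrt (totalWeight_pos hR x).le]
  calc _ = K * ∑ j, (totalWeight R x * ‖partialDeriv j ψ x‖ ^ 2
          + x j / weight R (x j) * inner ℝ (ψ x) (partialDeriv j ψ x))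
        + totalWeight R x * ((potential v w Z x - e) * ‖ψ x‖ ^ 2) := by
        symm
        rw [Finset.sum_add_distrib, ← Finset.mul_sum, mul_add, totalWeight, Finset.sum_mul,
          Finset.sum_mul, Finset.mul_sum, Finset.mul_sum, ← Finset.sum_add_distrib,
          ← Finset.sum_add_distrib]
        refine Finset.sum_congr rfl fun k _ => ?_
        rw [reducedDensity_eq, oneBodyDensity, potential_eq_add_removeNth v w Z x k,
          Fin.sum_univ_succAbove _ k]
        ring
    _ ≤ _ := by
        rw [energyDensity, hnorm, mul_left_comm]
        gcongr with j
        exact hkin j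

end GroundStateSubstitution

section OneBody

variable {n : ℕ} {E : Type*} [NormedAddCommGroup E] [InnerProductSpace ℝ E]

/-- The constant in front of `Z (1 + log² R)` in the one-body inequality. -/
def oneBodyConst (C : ℝ) : ℝ := 1 / 2 + 2 * C + 4 * C ^ 2

lemma oneBodyConst_pos {C : ℝ} (hC : 0 ≤ C) : 0 < oneBodyConst C := by
  unfold oneBodyConst
  positivity

/-- AM-GM, once for each half of `L (1 + L) d²`; the hypothesis `T ≤ L` serves to bound
`(1 + L) T² / L` by `2 (1 + T²)`. -/
lemma cross_terms_le_add {C L T p d : ℝ} (hL : 0 < L) (hT : 0 ≤ T) (hTL : T ≤ L) :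
    L * (p * d) + 2 * C * (1 + L) * T * (p * d)
      ≤ L * (1 + L) * d ^ 2 + (1 / 2 + 4 * C ^ 2 * (1 + T ^ 2)) * p ^ 2 := by
  have hlinear : L * (p * d) ≤ L * (1 + L) / 2 * d ^ 2 + p ^ 2 / 2 := by
    have : 0 ≤ (L * d - p) ^ 2 + L * d ^ 2 := by positivity
    linarith
  have hsquare : 2 * C * (1 + L) * T * (p * d) ≤ L * (1 + L) / 2 * d ^ 2
      + (2 * C ^ 2 * p ^ 2) * ((1 + L) * T ^ 2 / L) := by
    have : 0 ≤ (1 + L) / (2 * L) * (L * d - 2 * C * T * p) ^ 2 := by positivity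
    have : (1 + L) / (2 * L) * (L * d - 2 * C * T * p) ^ 2 = L * (1 + L) / 2 * d ^ 2
        + (2 * C ^ 2 * p ^ 2) * ((1 + L) * T ^ 2 / L) - 2 * C * (1 + L) * T * (p * d) := by
      field_simp
      ring
    linarith
  have hquotient : (1 + L) * T ^ 2 / L ≤ 2 * (1 + T ^ 2) := by
    rw [div_le_iff₀ hL]
    nlinarith [sq_nonneg (T - 1), mul_nonneg hT (sub_nonneg.2 hTL)]
  have := mul_le_mul_of_nonneg_left hquotient (show 0 ≤ 2 * C ^ 2 * p ^ 2 by positivity)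
  linarith

lemma partialDeriv_arsinhDiff_mul_norm_sq {R : ℝ} (hR : 0 < R) {ψ : (Fin n → ℝ) → E}
    (hψ : Differentiable ℝ ψ) (k : Fin n) (x : Fin n → ℝ) :
    partialDeriv k (fun x => arsinhDiff R (x k) * ‖ψ x‖ ^ 2) x
      = ((√(1 + x k ^ 2))⁻¹ - (weight R (x k))⁻¹) * ‖ψ x‖ ^ 2
        + 2 * arsinhDiff R (x k) * inner ℝ (ψ x) (partialDeriv k ψ x) := by
  have h := ((hasDerivAt_arsinhDiff hR (x k)).mul (hasDerivAt_partialDeriv hψ k x).norm_sq).deriv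
  simp only [Function.update_eq_self] at h
  rw [partialDeriv]
  simp only [Function.update_self]
  refine h.trans ?_
  ring

lemma neg_sub_partialDeriv_arsinhDiff_le_oneBodyDensity {v : ℝ → ℝ} {C Z L : ℝ}
    (hv : IsAttraction v C) (hZ : 0 ≤ Z) (hL : 0 < L) {ψ : (Fin n → ℝ) → E}
    (hψ : Differentiable ℝ ψ) (k : Fin n) (x : Fin n → ℝ) :
    -(oneBodyConst C * Z * (1 + Real.log (1 + L) ^ 2)) * ‖ψ x‖ ^ 2
        - Z * C * (1 + L) * partialDeriv k (fun x => arsinhDiff (1 + L) (x k) * ‖ψ x‖ ^ 2) x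
      ≤ oneBodyDensity v Z (Z * L) (1 + L) ψ k x := by
  have hR : 0 < 1 + L := by linarith
  have hC : 0 ≤ C := hv.const_nonneg
  rw [partialDeriv_arsinhDiff_mul_norm_sq hR hψ, oneBodyDensity]
  set g := weight (1 + L) (x k)
  set T := Real.log (1 + L)
  set p := ‖ψ x‖
  set d := ‖partialDeriv k ψ x‖
  set ρ := inner ℝ (ψ x) (partialDeriv k ψ x)
  have hρ : |ρ| ≤ p * d := abs_real_inner_le_norm _ _
  have hT : 0 ≤ T := Real.log_nonneg (by linarith)
  have hTL : T ≤ L := by linarith [Real.log_le_sub_one_of_pos hR]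
  have hattraction := mul_le_mul_of_nonneg_right (weight_mul_le hR hC (hv.le (x k)))
    (sq_nonneg p)
  have hgradient : -(p * d) ≤ x k / g * ρ := by
    refine neg_le_of_abs_le ((abs_mul _ _).trans_le ?_)
    exact (mul_le_mul (abs_div_weight_le_one hR _) hρ (abs_nonneg _) zero_le_one).trans_eq
      (one_mul _)
  have hderiv : -(T * (p * d)) ≤ arsinhDiff (1 + L) (x k) * ρ := by
    refine neg_le_of_abs_le ((abs_mul _ _).trans_le ?_)
    exact mul_le_mul (abs_arsinhDiff_le_log (by linarith) _) hρ (abs_nonneg _) hT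
  have hkinetic : L * ((1 + L) * d ^ 2) ≤ L * (g * d ^ 2) := by
    gcongr
    exact le_weight _ _
  have hLgradient := mul_le_mul_of_nonneg_left hgradient hL.le
  have hCderiv := mul_le_mul_of_nonneg_left hderiv (show 0 ≤ 2 * C * (1 + L) by positivity)
  have hcross := cross_terms_le_add (C := C) (p := p) (d := d) hL hT hTL
  have hslack : 0 ≤ (1 / 2 + 2 * C) * T ^ 2 * p ^ 2 := by positivity
  have hunscaled : -(oneBodyConst C * (1 + T ^ 2)) * p ^ 2
      - C * (1 + L) * (((√(1 + x k ^ 2))⁻¹ - g⁻¹) * p ^ 2 + 2 * arsinhDiff (1 + L) (x k) * ρ)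
      ≤ L * (g * d ^ 2 + x k / g * ρ) - g * v (x k) * p ^ 2 := by
    unfold oneBodyConst
    linarith
  linarith [mul_le_mul_of_nonneg_left hunscaled hZ]

end OneBody

section Bound

variable {n : ℕ} {E : Type*} [NormedAddCommGroup E] [InnerProductSpace ℝ E]
  {v w : ℝ → ℝ} {c C R Z L : ℝ}

/-- Symmetrizing in the two electrons replaces the weight of one of them by the mean of both, which
compensates the decay of `w`. -/
lemma mul_div_four_le_sum_weight_mul_repulsion (hw : IsRepulsion w c) (hR : 1 ≤ R)
    (x : Fin (n + 1) → ℝ) :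
    (n + 1) * (n * c / 4) ≤ ∑ k, weight R (x k) * ∑ i, w |x k - x (k.succAbove i)| := by
  have hsymm : ∑ k, weight R (x k) * ∑ i, w |x k - x (k.succAbove i)|
      = ∑ k, ∑ i : Fin n,
        (weight R (x k) + weight R (x (k.succAbove i))) / 2 * w |x k - x (k.succAbove i)| := by
    have hswap := sum_sum_succAbove_comm fun k j => weight R (x k) * w |x k - x j|
    simp only [fun k i => abs_sub_comm (x (Fin.succAbove k i)) (x k)] at hswap
    simp only [add_div, add_mul, Finset.sum_add_distrib, div_mul_eq_mul_div, ← Finset.sum_div,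
      Finset.mul_sum]
    linarith
  have hpair (k : Fin (n + 1)) (i : Fin n) : c / 4
      ≤ (weight R (x k) + weight R (x (k.succAbove i))) / 2 * w |x k - x (k.succAbove i)| := by
    set y := x (k.succAbove i)
    have hpos : 0 ≤ weight R (x k) + weight R y := by linarith [le_weight R (x k), le_weight R y]
    have hc : 0 ≤ c := hw.pos.le
    calc c / 4 = c / 2 * (1 / 2) := by ring
      _ ≤ c / 2 * ((weight R (x k) + weight R y) / (1 + |x k - y|)) :=
        mul_le_mul_of_nonneg_left (half_le_weight_add_weight_div hR _ _) (by positivity)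
      _ = (weight R (x k) + weight R y) / 2 * (c / (1 + |(|x k - y|)|)) := by
        rw [abs_abs]
        ring
      _ ≤ (weight R (x k) + weight R y) / 2 * w |x k - y| := by
        gcongr
        exact hw.ge _
  calc ((n : ℝ) + 1) * (n * c / 4) = ∑ _k : Fin (n + 1), ∑ _i : Fin n, c / 4 := by
        simp only [Finset.sum_const, Finset.card_univ, Fintype.card_fin, nsmul_eq_mul]
        push_cast
        ring
    _ ≤ _ := Finset.sum_le_sum fun k _ => Finset.sum_le_sum fun i _ => hpair k i
    _ = _ := hsymm.symm

lemma sum_weight_mul_reducedDensity_sub_le_energyDensity (hv : IsAttraction v C)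
    (hw : IsRepulsion w c) (hZ : 0 ≤ Z) (hL : 0 < L)
    (hn : 4 * (oneBodyConst C * Z * (1 + Real.log (1 + L) ^ 2)) ≤ n * c) (e : ℝ)
    {ψ : (Fin (n + 1) → ℝ) → E} (hψ : Differentiable ℝ ψ) (x : Fin (n + 1) → ℝ) :
    ∑ k, weight (1 + L) (x k)
          * reducedDensity (fun y => potential v w Z y - e) (Z * L) ψ k x
        - Z * C * (1 + L)
          * ∑ k, partialDeriv k (fun x => arsinhDiff (1 + L) (x k) * ‖ψ x‖ ^ 2) x
      ≤ energyDensity (fun x => potential v w Z x - e) (Z * L)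
          (fun x => √(totalWeight (1 + L) x) • ψ x) x := by
  have hdensity := sum_density_le_energyDensity_sqrt_totalWeight_smul v w Z e
    (show 0 < 1 + L by linarith) (mul_nonneg hZ hL.le) hψ x
  have honeBody := Finset.sum_le_sum fun k (_ : k ∈ Finset.univ) =>
    neg_sub_partialDeriv_arsinhDiff_le_oneBodyDensity hv hZ hL hψ k x
  have hrepulsion := mul_le_mul_of_nonneg_right
    (mul_div_four_le_sum_weight_mul_repulsion hw (show 1 ≤ 1 + L by linarith) x)
    (sq_nonneg ‖ψ x‖)
  have hlarge : ((n : ℝ) + 1) * (oneBodyConst C * Z * (1 + Real.log (1 + L) ^ 2)) * ‖ψ x‖ ^ 2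
      ≤ (n + 1) * (n * c / 4) * ‖ψ x‖ ^ 2 := by
    gcongr
    linarith
  rw [Finset.sum_sub_distrib, Finset.sum_const, Finset.card_univ, Fintype.card_fin, nsmul_eq_mul,
    ← Finset.mul_sum] at honeBody
  rw [Finset.sum_add_distrib, Finset.sum_add_distrib, ← Finset.sum_mul] at hdensity
  push_cast at honeBody
  linarith

lemma integrable_mul_reducedDensity {U : (Fin n → ℝ) → ℝ} (hU : IsBoundedMeasurable U)
    {g : ℝ → ℝ} (hg : Continuous g) (K : ℝ) {ψ : (Fin (n + 1) → ℝ) → E} (hψ : ContDiff ℝ ∞ ψ)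
    (hc : HasCompactSupport ψ) (k : Fin (n + 1)) :
    Integrable fun x => g (x k) * reducedDensity U K ψ k x := by
  have hgk : Continuous fun x : Fin (n + 1) → ℝ => g (x k) := hg.comp (continuous_apply k)
  have hkinetic (i : Fin n) :
      Integrable fun x => g (x k) * ‖partialDeriv (k.succAbove i) ψ x‖ ^ 2 :=
    (hgk.mul ((contDiff_partialDeriv hψ _).continuous.norm.pow 2))
      |>.integrable_of_hasCompactSupport (hasCompactSupport_norm_sq
        (hasCompactSupport_partialDeriv (hψ.differentiable (by simp)) hc _)).mul_left
  have hUk : IsBoundedMeasurable fun x : Fin (n + 1) → ℝ => U (k.removeNth x) :=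
    ⟨hU.measurable.comp (measurable_pi_lambda _ fun i => measurable_pi_apply _),
      hU.exists_abs_le.imp fun _ hD x => hD _⟩
  have hpotential : Integrable fun x => U (k.removeNth x) * (g (x k) * ‖ψ x‖ ^ 2) :=
    hUk.integrable_mul (hgk.mul (hψ.continuous.norm.pow 2)) (hasCompactSupport_norm_sq hc).mul_left
  refine (((integrable_finsetSum Finset.univ fun i _ => hkinetic i).const_mul K).add
    hpotential).congr (ae_of_all _ fun x => ?_)
  simp only [Pi.add_apply, reducedDensity_eq, ← Finset.mul_sum]
  ring

lemma integral_mul_reducedDensity_nonneg (hv : IsBoundedMeasurable v) (hw : IsBoundedMeasurable w)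
    {M e : ℝ} (he : (e : EReal) ≤ groundEnergy v w n Z M) {g : ℝ → ℝ} (hg : Continuous g)
    (hg0 : ∀ t, 0 ≤ g t) {ψ : (Fin (n + 1) → ℝ) → ℂ} (hψ : ContDiff ℝ ∞ ψ)
    (hc : HasCompactSupport ψ) (k : Fin (n + 1)) :
    0 ≤ ∫ x, g (x k) * reducedDensity (fun y => potential v w Z y - e) (1 / M) ψ k x := by
  have hU : IsBoundedMeasurable fun y : Fin n → ℝ => potential v w Z y - e :=
    (isBoundedMeasurable_potential hv hw Z).sub_const e
  refine integral_nonneg_of_insertNth (integrable_mul_reducedDensity hU hg _ hψ hc k) k fun t => ?_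
  simp only [reducedDensity, Fin.insertNth_apply_same, Fin.removeNth_insertNth,
    integral_const_mul]
  exact mul_nonneg (hg0 t) ((coe_le_groundEnergy_iff hv hw).1 he _
    (hψ.comp (contDiff_insertNth k t)) (hasCompactSupport_comp_insertNth hc k t))

lemma integral_energyDensity_sqrt_totalWeight_smul_nonneg (hv : IsAttraction v C)
    (hw : IsRepulsion w c) (hZ : 0 ≤ Z) (hL : 0 < L) {M e : ℝ} (hM : 1 / M = Z * L)
    (hn : 4 * (oneBodyConst C * Z * (1 + Real.log (1 + L) ^ 2)) ≤ n * c)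
    (he : (e : EReal) ≤ groundEnergy v w n Z M) {ψ : (Fin (n + 1) → ℝ) → ℂ}
    (hψ : ContDiff ℝ ∞ ψ) (hc : HasCompactSupport ψ) :
    0 ≤ ∫ x, energyDensity (fun x => potential v w Z x - e) (1 / M)
      (fun x => √(totalWeight (1 + L) x) • ψ x) x := by
  have hR : 0 < 1 + L := by linarith
  have hpot {m : ℕ} : IsBoundedMeasurable fun y : Fin m → ℝ => potential v w Z y - e :=
    (isBoundedMeasurable_potential hv.isBoundedMeasurable hw.isBoundedMeasurable Z).sub_const e
  have hflux (k : Fin (n + 1)) : ContDiff ℝ ∞ fun x => arsinhDiff (1 + L) (x k) * ‖ψ x‖ ^ 2 :=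
    ((contDiff_arsinhDiff _).comp (contDiff_apply ℝ ℝ k)).mul (hψ.norm_sq ℝ)
  have hfluxc (k : Fin (n + 1)) :
      HasCompactSupport fun x => arsinhDiff (1 + L) (x k) * ‖ψ x‖ ^ 2 :=
    (hasCompactSupport_norm_sq hc).mul_left
  have hreduced (k : Fin (n + 1)) := integrable_mul_reducedDensity hpot
    (contDiff_weight hR).continuous (1 / M) hψ hc k
  have hdiv := fun k => integrable_partialDeriv (hflux k) (hfluxc k) k
  have hΦ : ContDiff ℝ ∞ fun x => √(totalWeight (1 + L) x) • ψ x :=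
    ((contDiff_totalWeight hR).sqrt fun x => (totalWeight_pos hR x).ne').smul hψ
  have hΦc : HasCompactSupport fun x => √(totalWeight (1 + L) x) • ψ x :=
    hc.smul_left (f := fun x => √(totalWeight (1 + L) x))
  have hpoint := sum_weight_mul_reducedDensity_sub_le_energyDensity hv hw hZ hL hn e
    (hψ.differentiable (by simp))
  rw [← hM] at hpoint
  have hmono := integral_mono
    ((integrable_finsetSum Finset.univ fun k _ => hreduced k).sub
      ((integrable_finsetSum Finset.univ fun k _ => hdiv k).const_mul (Z * C * (1 + L))))
    (integrable_energyDensity hpot (1 / M) hΦ hΦc) hpoint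
  refine le_trans ?_ hmono
  rw [integral_sub' (integrable_finsetSum _ fun k _ => hreduced k)
      ((integrable_finsetSum _ fun k _ => hdiv k).const_mul _), integral_const_mul,
    integral_finsetSum _ fun k _ => hreduced k, integral_finsetSum _ fun k _ => hdiv k]
  simp only [integral_partialDeriv_eq_zero (hflux _) (hfluxc _), Finset.sum_const_zero, mul_zero,
    sub_zero]
  exact Finset.sum_nonneg fun k _ => integral_mul_reducedDensity_nonneg hv.isBoundedMeasurable
    hw.isBoundedMeasurable he (contDiff_weight hR).continuous (fun t => (weight_pos hR t).le)
    hψ hc k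

lemma groundEnergy_le_groundEnergy_succ (hv : IsAttraction v C) (hw : IsRepulsion w c)
    (hZ : 0 ≤ Z) (hL : 0 < L) {M : ℝ} (hM : 1 / M = Z * L)
    (hn : 4 * (oneBodyConst C * Z * (1 + Real.log (1 + L) ^ 2)) ≤ n * c) :
    groundEnergy v w n Z M ≤ groundEnergy v w (n + 1) Z M := by
  refine EReal.ge_of_forall_gt_iff_ge.1 fun e he =>
    (coe_le_groundEnergy_iff hv.isBoundedMeasurable hw.isBoundedMeasurable).2 fun Φ hΦ hΦc => ?_
  have hG (x : Fin (n + 1) → ℝ) : 0 < totalWeight (1 + L) x := totalWeight_pos (by linarith) x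
  have hsqrt : ContDiff ℝ ∞ fun x : Fin (n + 1) → ℝ => √(totalWeight (1 + L) x) :=
    (contDiff_totalWeight (by linarith)).sqrt fun x => (hG x).ne'
  have hne (x : Fin (n + 1) → ℝ) : √(totalWeight (1 + L) x) ≠ 0 := (Real.sqrt_pos.2 (hG x)).ne'
  have h := integral_energyDensity_sqrt_totalWeight_smul_nonneg hv hw hZ hL hM hn he.le
    (ψ := fun x => (√(totalWeight (1 + L) x))⁻¹ • Φ x) ((hsqrt.inv hne).smul hΦ)
    (hΦc.smul_left (f := fun x => (√(totalWeight (1 + L) x))⁻¹))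
  simpa only [smul_inv_smul₀ (hne _)] using h

theorem exists_forall_Nmax_le (hv : IsAttraction v C) (hw : IsRepulsion w c) :
    ∃ A : ℝ, 0 < A ∧ ∀ Z B : ℝ, 0 < Z → 0 < B →
      Nmax v w Z B ≤ ((1 + A * Z * (1 + Real.log (1 + √B / Z) ^ 2) : ℝ) : EReal) := by
  have hc := hw.pos
  have hC := oneBodyConst_pos hv.const_nonneg
  refine ⟨4 * oneBodyConst C / c, by positivity, fun Z B hZ hB => ?_⟩
  refine iSup₂_le fun N hN => EReal.coe_le_coe_iff.2 ?_
  obtain ⟨hN1, hlt⟩ := hN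
  obtain ⟨n, rfl⟩ := Nat.exists_eq_add_of_le' hN1
  by_contra! hlarge
  refine hlt.not_ge (groundEnergy_le_groundEnergy_succ hv hw hZ.le (L := √B / Z) (by positivity)
    ?_ ?_)
  · rw [Real.rpow_neg hB.le, ← Real.sqrt_eq_rpow]
    field_simp
  · have hn : 4 * oneBodyConst C / c * Z * (1 + Real.log (1 + √B / Z) ^ 2) ≤ n := by
      push_cast at hlarge
      linarith
    calc _ = 4 * oneBodyConst C / c * Z * (1 + Real.log (1 + √B / Z) ^ 2) * c := by field_simp
      _ ≤ n * c := by gcongr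

end Bound

section Logarithm

lemma log_one_add_sqrt_div_le {a y Z B : ℝ} (ha : 0 ≤ a) (hy : 0 ≤ y) (hZ : 1 ≤ Z)
    (hB : B ≤ a * Real.exp y) : Real.log (1 + √B / Z) ≤ Real.log (1 + √a) + y := by
  have hexp : 1 ≤ Real.exp y := Real.one_le_exp hy
  have hsqrt : √B ≤ √a * Real.exp y := calc
    √B ≤ √a * √(Real.exp y) := (Real.sqrt_le_sqrt hB).trans_eq (Real.sqrt_mul ha _)
    _ ≤ √a * Real.exp y := by
      gcongr
      exact (Real.sqrt_le_left (by positivity)).2 (le_self_pow₀ hexp two_ne_zero)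
  rw [← Real.log_exp y, ← Real.log_mul (by positivity) (Real.exp_ne_zero _)]
  refine Real.log_le_log (by positivity) ?_
  linarith [div_le_self (Real.sqrt_nonneg B) hZ]

lemma exists_forall_Nmax_le_of_le_exp {v w : ℝ → ℝ} {C c a : ℝ} (hv : IsAttraction v C)
    (hw : IsRepulsion w c) (ha : 0 ≤ a) :
    ∃ A : ℝ, 0 < A ∧ ∀ Z B y : ℝ, 1 ≤ Z → 0 ≤ y → 0 < B → B ≤ a * Real.exp y →
      Nmax v w Z B ≤ ((A * Z * (1 + y) ^ 2 : ℝ) : EReal) := by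
  obtain ⟨A, hA, hN⟩ := exists_forall_Nmax_le hv hw
  set ℓ := Real.log (1 + √a)
  have hℓ : 0 ≤ ℓ := Real.log_nonneg (by linarith [Real.sqrt_nonneg a])
  refine ⟨1 + A * (1 + ℓ) ^ 2, by positivity, fun Z B y hZ hy hB hBy =>
    (hN Z B (by linarith) hB).trans (EReal.coe_le_coe_iff.2 ?_)⟩
  have hlog : 0 ≤ Real.log (1 + √B / Z) :=
    Real.log_nonneg (le_add_of_nonneg_right (by positivity))
  have hsq : 1 + Real.log (1 + √B / Z) ^ 2 ≤ ((1 + ℓ) * (1 + y)) ^ 2 := calc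
    1 + Real.log (1 + √B / Z) ^ 2 ≤ (1 + Real.log (1 + √B / Z)) ^ 2 := by nlinarith
    _ ≤ ((1 + ℓ) * (1 + y)) ^ 2 := by
      gcongr
      linarith [log_one_add_sqrt_div_le ha hy hZ hBy, mul_nonneg hℓ hy]
  have hone : 1 ≤ Z * (1 + y) ^ 2 := one_le_mul_of_one_le_of_one_le hZ (one_le_pow₀ (by linarith))
  calc 1 + A * Z * (1 + Real.log (1 + √B / Z) ^ 2)
      ≤ Z * (1 + y) ^ 2 + A * Z * ((1 + ℓ) * (1 + y)) ^ 2 := by gcongr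
    _ = (1 + A * (1 + ℓ) ^ 2) * Z * (1 + y) ^ 2 := by ring

end Logarithm

end LandauModel

end

theorem mainTheorem5_general {v w : ℝ → ℝ} {C c : ℝ} (hv : LandauModel.IsAttraction v C)
    (hw : LandauModel.IsRepulsion w c) :
    (∀ α : ℝ, 0 < α → ∃ A : ℝ, 0 < A ∧ ∀ Z B : ℝ, 1 ≤ Z → 0 < B → B ≤ Real.exp (Z ^ (α / 2)) →
      LandauModel.Nmax v w Z B ≤ ((A * Z ^ (1 + α) : ℝ) : EReal)) ∧
    (∀ a p : ℝ, 0 < a → ∃ A : ℝ, 0 < A ∧ ∀ Z : ℝ, 2 ≤ Z →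
      LandauModel.Nmax v w Z (a * Z ^ p) ≤ ((A * Z * Real.log Z ^ 2 : ℝ) : EReal)) := by
  refine ⟨fun α hα => ?_, fun a p ha => ?_⟩
  · obtain ⟨A, hA, hN⟩ := LandauModel.exists_forall_Nmax_le_of_le_exp hv hw zero_le_one
    refine ⟨A * 4, by positivity, fun Z B hZ hB hBZ => ?_⟩
    have hZ0 : 0 < Z := by linarith
    have hy : 1 ≤ Z ^ (α / 2) := Real.one_le_rpow hZ (by positivity)
    refine (hN Z B (Z ^ (α / 2)) hZ (by positivity) hB (by rwa [one_mul])).trans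
      (EReal.coe_le_coe_iff.2 ?_)
    calc A * Z * (1 + Z ^ (α / 2)) ^ 2 ≤ A * Z * (2 * Z ^ (α / 2)) ^ 2 := by
          gcongr
          linarith
      _ = A * 4 * Z ^ (1 + α) := by
          rw [mul_pow, ← Real.rpow_mul_natCast hZ0.le, Real.rpow_add hZ0, Real.rpow_one,
            Nat.cast_ofNat, div_mul_cancel₀ α two_ne_zero]
          ring
  · obtain ⟨A, hA, hN⟩ := LandauModel.exists_forall_Nmax_le_of_le_exp hv hw ha.le
    refine ⟨A * (2 + |p|) ^ 2, by positivity, fun Z hZ => ?_⟩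
    have hZ0 : 0 < Z := by linarith
    have hlog : 1 / 2 ≤ Real.log Z := by
      linarith [Real.log_le_log two_pos hZ, Real.log_two_gt_d9]
    have hpow : a * Z ^ p ≤ a * Real.exp (|p| * Real.log Z) := by
      rw [Real.rpow_def_of_pos hZ0, mul_comm (Real.log Z)]
      gcongr
      exact le_abs_self p
    refine (hN Z _ _ (by linarith) (by positivity) (by positivity) hpow).trans
      (EReal.coe_le_coe_iff.2 ?_)
    calc A * Z * (1 + |p| * Real.log Z) ^ 2 ≤ A * Z * ((2 + |p|) * Real.log Z) ^ 2 := by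
          gcongr
          linarith
      _ = A * (2 + |p|) ^ 2 * Z * Real.log Z ^ 2 := by ring

theorem mainTheorem5 (m : ℕ) (w : ℝ → ℝ)
    (hw : w = LandauModel.W m m ∨ w = LandauModel.WLower m) :
    (∃ a₁ : ℝ, 0 < a₁ ∧ ∃ a₂ : ℝ, 0 < a₂ ∧ ∀ α : ℝ, 0 < α → ∃ A : ℝ, 0 < A ∧
      ∀ ε : ℝ, 0 < ε → ∀ Z B : ℝ, 1 ≤ Z →
        B < a₁ * Real.exp (Z ^ (α / 4)) → a₂ * Z ^ (2 + ε) ≤ B →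
          LandauModel.Nmax (LandauModel.V m) w Z B
            ≤ ((2 * Z + A * Z ^ (1 + α) : ℝ) : EReal)) ∧
    (∀ a p : ℝ, 0 < a → 3 < p → ∃ A : ℝ, 0 < A ∧ ∀ Z : ℝ, 2 ≤ Z →
      LandauModel.Nmax (LandauModel.V m) w Z (a * Z ^ p)
        ≤ ((3 * Z + A * Z * (Real.log Z) ^ 2 : ℝ) : EReal)) := by
  obtain ⟨C, hv⟩ := LandauModel.exists_isAttraction_V m
  obtain ⟨c, hrep⟩ : ∃ c, LandauModel.IsRepulsion w c := by
    rcases hw with rfl | rfl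
    exacts [LandauModel.exists_isRepulsion_W m m, LandauModel.exists_isRepulsion_WLower m]
  obtain ⟨hexp, hpow⟩ := mainTheorem5_general hv hrep
  refine ⟨⟨1, one_pos, 1, one_pos, fun α hα => ?_⟩, fun a p ha _ => ?_⟩
  · obtain ⟨A, hA, hN⟩ := hexp α hα
    refine ⟨A, hA, fun ε _ Z B hZ hBZ hB => (hN Z B hZ (lt_of_lt_of_le (by positivity) hB) ?_).trans
      (EReal.coe_le_coe_iff.2 (le_add_of_nonneg_left (by linarith)))⟩
    refine (hBZ.trans_eq (one_mul _)).le.trans (Real.exp_le_exp.2 ?_)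
    exact Real.rpow_le_rpow_of_exponent_le hZ (by linarith)
  · obtain ⟨A, hA, hN⟩ := hpow a p ha
    exact ⟨A, hA, fun Z hZ => (hN Z hZ).trans
      (EReal.coe_le_coe_iff.2 (le_add_of_nonneg_left (by linarith)))⟩
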